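/- Let $\mathbb{K}$ be a field of characteristic zero and $\mathcal{D}$ a set. A \emph{partitioned tree} decorated by $\mathcal{D}$ is a finite nonempty rooted forest, with vertices decorated by elements of $\mathcal{D}$, together with a partition of its vertices into blocks such that all the roots form one block and two non-root vertices in the same block have the same parent. Let $ComPrelie(\mathcal{D})$ be the $\mathbb{K}$-vector space with basis the isomorphism classes of such partitioned trees, with the bilinear products defined on basis elements as follows: $t \mathbin{\sqcup\!\!\sqcup} t'$ is the disjoint union of $t$ and $t'$ with the two root blocks merged into one block; $t\bullet t'$ is the sum, over all vertices $s$ of $t$, of the partitioned trees obtained by grafting all the roots of $t'$ on $s$ (the blocks of $t$ and of $t'$ being kept). Let $Prelie(\mathcal{D})\subseteq ComPrelie(\mathcal{D})$ be the subspace with basis the rooted trees, i.e. the partitioned trees all of whose blocks have cardinality one; it is stable under $\bullet$ (it is the rooted tree model of the free pre-Lie algebra on $\mathcal{D}$). Let $\mathfrak{h}_{\mathcal{D}}$ be the (non-unital) subalgebra of $(ComPrelie(\mathcal{D}),\sqcup\!\!\sqcup)$ generated by $Prelie(\mathcal{D})$. Let $V_{\mathcal{D}}$ be the space with basis the biletters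 $\binom{k}{d}$, $k\in\mathbb{N}$, $d\in\mathcal{D}$, and $f_{\mathcal{D}}$ its endomorphism $\binom{k}{d}\mapsto\binom{k+1}{d}$. Let $T(V_{\mathcal{D}},f_{\mathcal{D}})$ be the space $T(V_{\mathcal{D}})$ of linear combinations of words in biletters, with the shuffle product $\sqcup\!\!\sqcup$ and the bilinear product $\bullet$ defined by $\emptyset\bullet w'=0$ and $xw\bullet w'=x(w\bullet w')+f_{\mathcal{D}}(x)(w\mathbin{\sqcup\!\!\sqcup} w')$ for $x\in V_{\mathcal{D}}$, $w,w'\in T(V_{\mathcal{D}})$. Then there is a unique linear map $\Phi_{CPL}:ComPrelie(\mathcal{D})\to T(V_{\mathcal{D}},f_{\mathcal{D}})$ that is compatible with $\sqcup\!\!\sqcup$ and $\bullet$ and sends the one-vertex tree decorated by $d$ to $\binom{0}{d}$ for all $d\in\mathcal{D}$; there is a unique linear map $\Phi_{PL}:Prelie(\mathcal{D})\to T(V_{\mathcal{D}},f_{\mathcal{D}})$ that is compatible with $\bullet$ and sends the one-vertex tree decorated by $d$ to $\binom{0}{d}$ for all $d\in\mathcal{D}$; and $\Phi_{PL}$ is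 the restriction of $\Phi_{CPL}$ to $Prelie(\mathcal{D})$. Moreover $\Phi_{PL}$ is injective, and the restriction of $\Phi_{CPL}$ to $\mathfrak{h}_{\mathcal{D}}$ is injective. -/

import Mathlib

universe u v w

/-! ### Partitioned trees decorated by `D`

A partitioned tree is a nonempty block of roots; every vertex carries a decoration and a finite
collection of blocks of children, and no order is put on the vertices of a block nor on the blocks of
children of a vertex.  Planar representatives come first; isomorphism classes are obtained from them
by forgetting these orders. -/

mutual
/-- A planar decorated partitioned tree: a nonempty list of roots, all in the same block. A root is
given by its decoration `d` and the list `c` of the blocks of its children. -/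
inductive PlanarBlock (D : Type u) : Type u
  /-- the block consists of one vertex -/
  | single (d : D) (c : PlanarBlocks D) : PlanarBlock D
  /-- a vertex followed by the remaining vertices of the block -/
  | cons (d : D) (c : PlanarBlocks D) (b : PlanarBlock D) : PlanarBlock D
/-- A finite, possibly empty list of blocks (with everything above them). -/
inductive PlanarBlocks (D : Type u) : Type u
  | nil : PlanarBlocks D
  | cons (b : PlanarBlock D) (F : PlanarBlocks D) : PlanarBlocks D
end

mutual
/-- Two planar partitioned trees are isomorphic: the smallest congruence that allows the exchange of
neighbouring vertices of a block and of neighbouring blocks of children of a vertex. -/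
inductive PlanarBlock.Iso {D : Type u} : PlanarBlock D → PlanarBlock D → Prop
  | refl (b : PlanarBlock D) : PlanarBlock.Iso b b
  | symm {b b' : PlanarBlock D} : PlanarBlock.Iso b b' → PlanarBlock.Iso b' b
  | trans {b b' b'' : PlanarBlock D} :
      PlanarBlock.Iso b b' → PlanarBlock.Iso b' b'' → PlanarBlock.Iso b b''
  | single (d : D) {c c' : PlanarBlocks D} :
      PlanarBlocks.Iso c c' → PlanarBlock.Iso (.single d c) (.single d c')
  | cons (d : D) {c c' : PlanarBlocks D} {b b' : PlanarBlock D} :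
      PlanarBlocks.Iso c c' → PlanarBlock.Iso b b' → PlanarBlock.Iso (.cons d c b) (.cons d c' b')
  | swapLast (d e : D) (c c' : PlanarBlocks D) :
      PlanarBlock.Iso (.cons d c (.single e c')) (.cons e c' (.single d c))
  | swap (d e : D) (c c' : PlanarBlocks D) (b : PlanarBlock D) :
      PlanarBlock.Iso (.cons d c (.cons e c' b)) (.cons e c' (.cons d c b))
/-- The same for lists of blocks. -/
inductive PlanarBlocks.Iso {D : Type u} : PlanarBlocks D → PlanarBlocks D → Prop
  | refl (F : PlanarBlocks D) : PlanarBlocks.Iso F F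
  | symm {F F' : PlanarBlocks D} : PlanarBlocks.Iso F F' → PlanarBlocks.Iso F' F
  | trans {F F' F'' : PlanarBlocks D} :
      PlanarBlocks.Iso F F' → PlanarBlocks.Iso F' F'' → PlanarBlocks.Iso F F''
  | cons {b b' : PlanarBlock D} {F F' : PlanarBlocks D} :
      PlanarBlock.Iso b b' → PlanarBlocks.Iso F F' → PlanarBlocks.Iso (.cons b F) (.cons b' F')
  | swap (b b' : PlanarBlock D) (F : PlanarBlocks D) :
      PlanarBlocks.Iso (.cons b (.cons b' F)) (.cons b' (.cons b F))
end

instance PlanarBlock.setoid (D : Type u) : Setoid (PlanarBlock D) where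
  r := PlanarBlock.Iso
  iseqv := ⟨.refl, .symm, .trans⟩

instance PlanarBlocks.setoid (D : Type u) : Setoid (PlanarBlocks D) where
  r := PlanarBlocks.Iso
  iseqv := ⟨.refl, .symm, .trans⟩

/-- Isomorphism classes of partitioned trees decorated by `D`. -/
def PartTree (D : Type u) : Type u := Quotient (PlanarBlock.setoid D)

/-- The isomorphism class of a planar partitioned tree. -/
def PartTree.mk {D : Type u} (b : PlanarBlock D) : PartTree D := Quotient.mk _ b

/-- The tree with a single vertex, decorated by `d`. -/
def PartTree.dot {D : Type u} (d : D) : PartTree D := .mk (.single d .nil)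

/-- The union of two partitioned trees, the two root blocks being merged into one block. -/
def PlanarBlock.merge {D : Type u} : PlanarBlock D → PlanarBlock D → PlanarBlock D
  | .single d c, b' => .cons d c b'
  | .cons d c b, b' => .cons d c (b.merge b')

mutual
/-- The multiset of all graftings of `t` on a vertex `s` of the first argument, where `s` runs over
all its vertices: the root block of `t` becomes a new block of children of `s`. -/
def PlanarBlock.graft {D : Type u} (t : PlanarBlock D) : PlanarBlock D → Multiset (PlanarBlock D)
  | .single d c =>
      {.single d (.cons t c)} + (PlanarBlocks.graft t c).map (fun c' => .single d c')
  | .cons d c b =>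
      {.cons d (.cons t c) b} + (PlanarBlocks.graft t c).map (fun c' => .cons d c' b) +
        (PlanarBlock.graft t b).map (fun b' => .cons d c b')
/-- The same for lists of blocks. -/
def PlanarBlocks.graft {D : Type u} (t : PlanarBlock D) : PlanarBlocks D → Multiset (PlanarBlocks D)
  | .nil => 0
  | .cons b F =>
      (PlanarBlock.graft t b).map (fun b' => .cons b' F) +
        (PlanarBlocks.graft t F).map (fun F' => .cons b F')
end

/-! Compatibility of these operations with isomorphisms. -/

theorem PlanarBlock.Iso.merge_left {D : Type u} {b b' : PlanarBlock D} (h : b.Iso b')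
    (a : PlanarBlock D) : (b.merge a).Iso (b'.merge a) :=
  match h with
  | .refl _ => .refl _
  | .symm h => .symm (h.merge_left a)
  | .trans h h' => .trans (h.merge_left a) (h'.merge_left a)
  | .single d h => .cons d h (.refl a)
  | .cons d h h' => .cons d h (h'.merge_left a)
  | .swapLast d e c c' => .swap d e c c' a
  | .swap d e c c' b => .swap d e c c' (b.merge a)

theorem PlanarBlock.Iso.merge_right {D : Type u} (b : PlanarBlock D) {a a' : PlanarBlock D}
    (h : a.Iso a') : (b.merge a).Iso (b.merge a') :=
  match b with
  | .single d c => .cons d (.refl c) h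
  | .cons d c b => .cons d (.refl c) (PlanarBlock.Iso.merge_right b h)

/-- The class of a vertex with children, as a function of the class of its blocks of children. -/
def PartTree.single {D : Type u} (d : D) : Quotient (PlanarBlocks.setoid D) → PartTree D :=
  Quotient.lift (fun c => .mk (.single d c)) fun _ _ h => Quotient.sound (.single d h)

/-- Adding a vertex to the root block, on classes. -/
def PartTree.cons {D : Type u} (d : D) :
    Quotient (PlanarBlocks.setoid D) → PartTree D → PartTree D :=
  Quotient.lift₂ (fun c b => .mk (.cons d c b)) fun _ _ _ _ h h' => Quotient.sound (.cons d h h')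

/-- Adding a block, on classes. -/
def PartTree.consBlock {D : Type u} :
    PartTree D → Quotient (PlanarBlocks.setoid D) → Quotient (PlanarBlocks.setoid D) :=
  Quotient.lift₂ (fun b F => Quotient.mk _ (.cons b F)) fun _ _ _ _ h h' =>
    Quotient.sound (.cons h h')

theorem PartTree.consBlock_comm {D : Type u} (x y : PartTree D)
    (z : Quotient (PlanarBlocks.setoid D)) :
    consBlock x (consBlock y z) = consBlock y (consBlock x z) := by
  induction x using Quotient.inductionOn
  induction y using Quotient.inductionOn
  induction z using Quotient.inductionOn
  exact Quotient.sound (.swap _ _ _)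

theorem PartTree.cons_single_comm {D : Type u} (d e : D) (x y : Quotient (PlanarBlocks.setoid D)) :
    cons d x (single e y) = cons e y (single d x) := by
  induction x using Quotient.inductionOn
  induction y using Quotient.inductionOn
  exact Quotient.sound (.swapLast _ _ _ _)

theorem PartTree.cons_cons_comm {D : Type u} (d e : D) (x y : Quotient (PlanarBlocks.setoid D))
    (z : PartTree D) : cons d x (cons e y z) = cons e y (cons d x z) := by
  induction x using Quotient.inductionOn
  induction y using Quotient.inductionOn
  induction z using Quotient.inductionOn
  exact Quotient.sound (.swap _ _ _ _ _)

/-- The classes of the graftings of `t` on the vertices of a planar partitioned tree. -/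
def PlanarBlock.graftClass {D : Type u} (t b : PlanarBlock D) : Multiset (PartTree D) :=
  (PlanarBlock.graft t b).map PartTree.mk

/-- The same for lists of blocks. -/
def PlanarBlocks.graftClass {D : Type u} (t : PlanarBlock D) (F : PlanarBlocks D) :
    Multiset (Quotient (PlanarBlocks.setoid D)) :=
  (PlanarBlocks.graft t F).map (Quotient.mk _)

theorem PlanarBlock.graftClass_single {D : Type u} (t : PlanarBlock D) (d : D)
    (c : PlanarBlocks D) :
    graftClass t (.single d c) =
      {PartTree.single d (PartTree.consBlock (.mk t) (Quotient.mk _ c))} +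
        (PlanarBlocks.graftClass t c).map (PartTree.single d) := by
  simp only [graftClass, PlanarBlocks.graftClass, PlanarBlock.graft, Multiset.map_add,
    Multiset.map_map, Multiset.map_singleton]
  rfl

theorem PlanarBlock.graftClass_cons {D : Type u} (t : PlanarBlock D) (d : D)
    (c : PlanarBlocks D) (b : PlanarBlock D) :
    graftClass t (.cons d c b) =
      {PartTree.cons d (PartTree.consBlock (.mk t) (Quotient.mk _ c)) (.mk b)} +
        (PlanarBlocks.graftClass t c).map (fun x => PartTree.cons d x (.mk b)) +
        (graftClass t b).map (PartTree.cons d (Quotient.mk _ c)) := by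
  simp only [graftClass, PlanarBlocks.graftClass, PlanarBlock.graft, Multiset.map_add,
    Multiset.map_map, Multiset.map_singleton]
  rfl

theorem PlanarBlocks.graftClass_cons {D : Type u} (t b : PlanarBlock D) (F : PlanarBlocks D) :
    graftClass t (.cons b F) =
      (PlanarBlock.graftClass t b).map (fun x => PartTree.consBlock x (Quotient.mk _ F)) +
        (graftClass t F).map (PartTree.consBlock (.mk b)) := by
  simp only [PlanarBlock.graftClass, graftClass, PlanarBlocks.graft, Multiset.map_add,
    Multiset.map_map]
  rfl

mutual
theorem PlanarBlock.graftClass_congr_left {D : Type u} {t t' : PlanarBlock D} (h : t.Iso t') :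
    (b : PlanarBlock D) → PlanarBlock.graftClass t b = PlanarBlock.graftClass t' b
  | .single d c => by
      have e : PartTree.mk t = PartTree.mk t' := Quotient.sound h
      rw [PlanarBlock.graftClass_single, PlanarBlock.graftClass_single, PlanarBlocks.graftClass_congr_left h c, e]
  | .cons d c b => by
      have e : PartTree.mk t = PartTree.mk t' := Quotient.sound h
      rw [PlanarBlock.graftClass_cons, PlanarBlock.graftClass_cons, PlanarBlocks.graftClass_congr_left h c,
        PlanarBlock.graftClass_congr_left h b, e]
theorem PlanarBlocks.graftClass_congr_left {D : Type u} {t t' : PlanarBlock D} (h : t.Iso t') :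
    (F : PlanarBlocks D) → PlanarBlocks.graftClass t F = PlanarBlocks.graftClass t' F
  | .nil => rfl
  | .cons b F => by
      rw [PlanarBlocks.graftClass_cons, PlanarBlocks.graftClass_cons, PlanarBlock.graftClass_congr_left h b,
        PlanarBlocks.graftClass_congr_left h F]
end

mutual
theorem PlanarBlock.graftClass_congr_right {D : Type u} (t : PlanarBlock D) :
    {b b' : PlanarBlock D} → b.Iso b' → PlanarBlock.graftClass t b = PlanarBlock.graftClass t b'
  | _, _, .refl _ => rfl
  | _, _, .symm h => (PlanarBlock.graftClass_congr_right t h).symm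
  | _, _, .trans h h' =>
      (PlanarBlock.graftClass_congr_right t h).trans (PlanarBlock.graftClass_congr_right t h')
  | _, _, .single (c := c) (c' := c') d h => by
      have e : (Quotient.mk _ c : Quotient (PlanarBlocks.setoid D)) = Quotient.mk _ c' :=
        Quotient.sound h
      rw [PlanarBlock.graftClass_single, PlanarBlock.graftClass_single, PlanarBlocks.graftClass_congr_right t h, e]
  | _, _, .cons (c := c) (c' := c') (b := b) (b' := b') d h h' => by
      have e : (Quotient.mk _ c : Quotient (PlanarBlocks.setoid D)) = Quotient.mk _ c' :=
        Quotient.sound h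
      have e' : PartTree.mk b = PartTree.mk b' := Quotient.sound h'
      rw [PlanarBlock.graftClass_cons, PlanarBlock.graftClass_cons, PlanarBlocks.graftClass_congr_right t h,
        PlanarBlock.graftClass_congr_right t h', e, e']
  | _, _, .swapLast d e c c' => by
      have k (d : D) (c : PlanarBlocks D) :
        PartTree.mk (.single d c) = PartTree.single d (Quotient.mk _ c) := rfl
      simp only [PlanarBlock.graftClass_cons, PlanarBlock.graftClass_single, Multiset.map_add, Multiset.map_map,
        Multiset.map_singleton, Function.comp_def, k, PartTree.cons_single_comm e d]
      abel
  | _, _, .swap d e c c' b => by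
      have k (d : D) (c : PlanarBlocks D) (b : PlanarBlock D) :
        PartTree.mk (.cons d c b) = PartTree.cons d (Quotient.mk _ c) (.mk b) := rfl
      simp only [PlanarBlock.graftClass_cons, Multiset.map_add, Multiset.map_map,
        Multiset.map_singleton, Function.comp_def, k, PartTree.cons_cons_comm e d]
      abel
theorem PlanarBlocks.graftClass_congr_right {D : Type u} (t : PlanarBlock D) :
    {F F' : PlanarBlocks D} → F.Iso F' → PlanarBlocks.graftClass t F = PlanarBlocks.graftClass t F'
  | _, _, .refl _ => rfl
  | _, _, .symm h => (PlanarBlocks.graftClass_congr_right t h).symm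
  | _, _, .trans h h' =>
      (PlanarBlocks.graftClass_congr_right t h).trans (PlanarBlocks.graftClass_congr_right t h')
  | _, _, .cons (b := b) (b' := b') (F := F) (F' := F') h h' => by
      have e : (Quotient.mk _ F : Quotient (PlanarBlocks.setoid D)) = Quotient.mk _ F' :=
        Quotient.sound h'
      have e' : PartTree.mk b = PartTree.mk b' := Quotient.sound h
      rw [PlanarBlocks.graftClass_cons, PlanarBlocks.graftClass_cons, PlanarBlock.graftClass_congr_right t h,
        PlanarBlocks.graftClass_congr_right t h', e, e']
  | _, _, .swap b b' F => by
      have k (b : PlanarBlock D) (F : PlanarBlocks D) :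
        (Quotient.mk _ (.cons b F) : Quotient (PlanarBlocks.setoid D)) =
          PartTree.consBlock (.mk b) (Quotient.mk _ F) := rfl
      have hb : (fun x => PartTree.consBlock (.mk b) (PartTree.consBlock x (Quotient.mk _ F))) =
          fun x => PartTree.consBlock x (PartTree.consBlock (.mk b) (Quotient.mk _ F)) :=
        funext fun x => PartTree.consBlock_comm _ _ _
      simp only [PlanarBlocks.graftClass_cons, Multiset.map_add, Multiset.map_map, Function.comp_def, k]
      simp only [hb, PartTree.consBlock_comm (.mk b') _ _]
      abel
end

/-- The commutative product of two partitioned trees: union, with the root blocks merged. -/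
def PartTree.merge {D : Type u} : PartTree D → PartTree D → PartTree D :=
  Quotient.map₂ PlanarBlock.merge fun b _ h _ a' h' =>
    .trans (PlanarBlock.Iso.merge_right b h') (h.merge_left a')

/-- The multiset of the partitioned trees `t •ₛ t'`, where `s` runs over the vertices of `t`. -/
def PartTree.graft {D : Type u} : PartTree D → PartTree D → Multiset (PartTree D) :=
  Quotient.lift₂ (fun t t' => PlanarBlock.graftClass t' t) fun _ _ _ b' h h' =>
    (PlanarBlock.graftClass_congr_left h' _).trans (PlanarBlock.graftClass_congr_right b' h)

mutual
/-- All blocks have cardinality one, i.e. the partitioned tree is a rooted tree. -/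
def PlanarBlock.IsRootedTree {D : Type u} : PlanarBlock D → Prop
  | .single _ c => c.AreRootedTrees
  | .cons _ _ _ => False
/-- The same for every block of a list. -/
def PlanarBlocks.AreRootedTrees {D : Type u} : PlanarBlocks D → Prop
  | .nil => True
  | .cons b F => b.IsRootedTree ∧ F.AreRootedTrees
end

/-- Rooted trees, identified with the partitioned trees all of whose blocks have cardinality one. -/
def PartTree.IsRootedTree {D : Type u} (t : PartTree D) : Prop :=
  ∃ b : PlanarBlock D, b.IsRootedTree ∧ PartTree.mk b = t

mutual
theorem PlanarBlock.IsRootedTree.graft {D : Type u} {t : PlanarBlock D} (ht : t.IsRootedTree) :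
    (b : PlanarBlock D) → b.IsRootedTree → ∀ s ∈ PlanarBlock.graft t b, s.IsRootedTree
  | .single d c, hb, s, hs => by
      simp only [PlanarBlock.graft, Multiset.mem_add, Multiset.mem_singleton,
        Multiset.mem_map] at hs
      obtain rfl | ⟨c', hc', rfl⟩ := hs
      · exact ⟨ht, hb⟩
      · exact PlanarBlocks.AreRootedTrees.graft ht c hb c' hc'
  | .cons _ _ _, hb, _, _ => hb.elim
theorem PlanarBlocks.AreRootedTrees.graft {D : Type u} {t : PlanarBlock D} (ht : t.IsRootedTree) :
    (F : PlanarBlocks D) → F.AreRootedTrees → ∀ s ∈ PlanarBlocks.graft t F, s.AreRootedTrees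
  | .nil, _, s, hs => by simp [PlanarBlocks.graft] at hs
  | .cons b F, hF, s, hs => by
      simp only [PlanarBlocks.graft, Multiset.mem_add, Multiset.mem_map] at hs
      obtain ⟨b', hb', rfl⟩ | ⟨F', hF', rfl⟩ := hs
      · exact ⟨PlanarBlock.IsRootedTree.graft ht b hF.1 b' hb', hF.2⟩
      · exact ⟨hF.1, PlanarBlocks.AreRootedTrees.graft ht F hF.2 F' hF'⟩
end

theorem PartTree.IsRootedTree.graft {D : Type u} {t t' : PartTree D} (h : t.IsRootedTree)
    (h' : t'.IsRootedTree) : ∀ s ∈ PartTree.graft t t', s.IsRootedTree := by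
  obtain ⟨b, hb, rfl⟩ := h
  obtain ⟨b', hb', rfl⟩ := h'
  intro s hs
  obtain ⟨a, ha, rfl⟩ := Multiset.mem_map.1 hs
  exact ⟨a, hb'.graft b hb a ha, rfl⟩

/-! ### The Com-Pre-Lie algebra of partitioned trees and the pre-Lie algebra of rooted trees -/

noncomputable section

/-- The vector space with basis the partitioned trees decorated by `D`. -/
abbrev ComPrelie (K : Type v) [Field K] (D : Type u) : Type (max u v) := PartTree D →₀ K

/-- The commutative product of `ComPrelie K D`. -/
def ComPrelie.shuffle (K : Type v) [Field K] (D : Type u) :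
    ComPrelie K D →ₗ[K] ComPrelie K D →ₗ[K] ComPrelie K D :=
  Finsupp.linearCombination K fun t =>
    Finsupp.linearCombination K fun t' => Finsupp.single (t.merge t') 1

/-- The pre-Lie product of `ComPrelie K D`: `t • t'` is the sum, over the vertices `s` of `t`, of the
graftings of `t'` on `s`. -/
def ComPrelie.preLie (K : Type v) [Field K] (D : Type u) :
    ComPrelie K D →ₗ[K] ComPrelie K D →ₗ[K] ComPrelie K D :=
  Finsupp.linearCombination K fun t =>
    Finsupp.linearCombination K fun t' => ((t.graft t').map fun s => Finsupp.single s (1 : K)).sum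

/-- The one-vertex tree decorated by `d`, as an element of `ComPrelie K D`. -/
def ComPrelie.dot (K : Type v) [Field K] {D : Type u} (d : D) : ComPrelie K D :=
  Finsupp.single (PartTree.dot d) 1

/-- The space with basis the rooted trees decorated by `D`, inside `ComPrelie K D`. -/
def Prelie (K : Type v) [Field K] (D : Type u) : Submodule K (ComPrelie K D) :=
  Submodule.span K {x | ∃ t : PartTree D, t.IsRootedTree ∧ x = Finsupp.single t 1}

theorem Prelie.preLie_mem {K : Type v} [Field K] {D : Type u} {x y : ComPrelie K D}
    (hx : x ∈ Prelie K D) (hy : y ∈ Prelie K D) : ComPrelie.preLie K D x y ∈ Prelie K D := by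
  refine LinearMap.BilinMap.apply_apply_mem_of_mem_span (Prelie K D) _ _ (ComPrelie.preLie K D)
    ?_ x y hx hy
  rintro _ ⟨t, ht, rfl⟩ _ ⟨t', ht', rfl⟩
  simp only [ComPrelie.preLie, Finsupp.linearCombination_single, one_smul]
  refine multiset_sum_mem _ fun z hz => ?_
  obtain ⟨s, hs, rfl⟩ := Multiset.mem_map.1 hz
  exact Submodule.subset_span ⟨s, ht.graft ht' s hs, rfl⟩

theorem Prelie.dot_mem (K : Type v) [Field K] {D : Type u} (d : D) :
    ComPrelie.dot K d ∈ Prelie K D :=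
  Submodule.subset_span ⟨PartTree.dot d, ⟨.single d .nil, trivial, rfl⟩, rfl⟩

/-- The one-vertex tree decorated by `d`, as an element of `Prelie K D`. -/
def Prelie.dot (K : Type v) [Field K] {D : Type u} (d : D) : Prelie K D :=
  ⟨ComPrelie.dot K d, Prelie.dot_mem K d⟩

/-- The pre-Lie product of `Prelie K D` (grafting of rooted trees). -/
def Prelie.preLie {K : Type v} [Field K] {D : Type u} (x y : Prelie K D) : Prelie K D :=
  ⟨ComPrelie.preLie K D x y, Prelie.preLie_mem x.2 y.2⟩

/-- The (non-unital) subalgebra of `ComPrelie K D` for the commutative product generated by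
`Prelie K D`; it is spanned by the rooted forests, the roots of a forest forming one block. -/
def forestAlgebra (K : Type v) [Field K] (D : Type u) : Submodule K (ComPrelie K D) :=
  sInf {S | Prelie K D ≤ S ∧ ∀ x ∈ S, ∀ y ∈ S, ComPrelie.shuffle K D x y ∈ S}

/-! ### The Com-Pre-Lie algebra `T(V, f)` for a space `V` with basis `X` -/

/-- `T(V)`, where `V` has basis `X`: the space with basis the words in `X`. -/
abbrev TensorWords (K : Type v) [Field K] (X : Type w) : Type (max v w) := List X →₀ K

/-- The concatenation `x w` of a vector `x` of `V` and an element `w` of `T(V)`. -/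
def TensorWords.cons (K : Type v) [Field K] (X : Type w) :
    (X →₀ K) →ₗ[K] TensorWords K X →ₗ[K] TensorWords K X :=
  Finsupp.linearCombination K fun x => Finsupp.lmapDomain K K (List.cons x)

/-- The shuffle product of two words. -/
def TensorWords.shuffleWord (K : Type v) [Field K] {X : Type w} :
    List X → List X → TensorWords K X
  | [], v => Finsupp.single v 1
  | x :: u, [] => Finsupp.single (x :: u) 1
  | x :: u, y :: v =>
      TensorWords.cons K X (Finsupp.single x 1) (TensorWords.shuffleWord K u (y :: v)) +
        TensorWords.cons K X (Finsupp.single y 1) (TensorWords.shuffleWord K (x :: u) v)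
termination_by u v => u.length + v.length

/-- The product `∅ • w' = 0`, `x w • w' = x (w • w') + f(x) (w ⧢ w')` of two words. -/
def TensorWords.preLieWord {K : Type v} [Field K] {X : Type w} (f : (X →₀ K) →ₗ[K] (X →₀ K)) :
    List X → List X → TensorWords K X
  | [], _ => 0
  | x :: w, w' =>
      TensorWords.cons K X (Finsupp.single x 1) (TensorWords.preLieWord f w w') +
        TensorWords.cons K X (f (Finsupp.single x 1)) (TensorWords.shuffleWord K w w')

/-- The shuffle product of `T(V)`. -/
def TensorWords.shuffle (K : Type v) [Field K] (X : Type w) :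
    TensorWords K X →ₗ[K] TensorWords K X →ₗ[K] TensorWords K X :=
  Finsupp.linearCombination K fun u =>
    Finsupp.linearCombination K fun v => TensorWords.shuffleWord K u v

/-- The pre-Lie product of `T(V, f)`. -/
def TensorWords.preLie {K : Type v} [Field K] {X : Type w} (f : (X →₀ K) →ₗ[K] (X →₀ K)) :
    TensorWords K X →ₗ[K] TensorWords K X →ₗ[K] TensorWords K X :=
  Finsupp.linearCombination K fun u =>
    Finsupp.linearCombination K fun v => TensorWords.preLieWord f u v

/-! ### The generic case: biletters -/

/-- The endomorphism `(k, d) ↦ (k + 1, d)` of the space `V_D` with basis the biletters `ℕ × D`. -/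
def biletterShift (K : Type v) [Field K] (D : Type u) : ((ℕ × D) →₀ K) →ₗ[K] ((ℕ × D) →₀ K) :=
  Finsupp.lmapDomain K K fun p => (p.1 + 1, p.2)

/-- The space of `T(V_D, f_D)`, with basis the biwords. -/
abbrev Biwords (K : Type v) [Field K] (D : Type u) : Type (max v u) := TensorWords K (ℕ × D)

/-- The biletter `(k, d)`, as a biword of length one. -/
def biletter (K : Type v) [Field K] {D : Type u} (k : ℕ) (d : D) : Biwords K D :=
  Finsupp.single [(k, d)] 1

/-- `Φ` is a Com-Pre-Lie morphism from `ComPrelie K D` to `T(V_D, f_D)` that sends each one-vertex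
tree `d` to the biletter `(0, d)`. -/
structure IsPhiCPL {K : Type v} [Field K] {D : Type u} (Φ : ComPrelie K D →ₗ[K] Biwords K D) :
    Prop where
  map_shuffle : ∀ x y, Φ (ComPrelie.shuffle K D x y) = TensorWords.shuffle K (ℕ × D) (Φ x) (Φ y)
  map_preLie : ∀ x y,
    Φ (ComPrelie.preLie K D x y) = TensorWords.preLie (biletterShift K D) (Φ x) (Φ y)
  map_dot : ∀ d, Φ (ComPrelie.dot K d) = biletter K 0 d

/-- `φ` is a pre-Lie morphism from `Prelie K D` to `T(V_D, f_D)` that sends each one-vertex tree `d`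
to the biletter `(0, d)`. -/
structure IsPhiPL {K : Type v} [Field K] {D : Type u} (φ : Prelie K D →ₗ[K] Biwords K D) :
    Prop where
  map_preLie : ∀ x y, φ (Prelie.preLie x y) = TensorWords.preLie (biletterShift K D) (φ x) (φ y)
  map_dot : ∀ d, φ (Prelie.dot K d) = biletter K 0 d

end

/-!
`Φ_CPL` sends a single-rooted tree with root `d` and blocks of children `t₁, …, tₖ` to the letter
`(k, d)` followed by the shuffle product of the `Φ_CPL(tᵢ)`, and a root block to the shuffle product
over its roots. It is compatible with `•` because `w ↦ w • w'` is a derivation of the shuffle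
product.

For uniqueness, grafting a block `t` on the tree `B(d; c)` with root `d` and blocks of children `c`
gives `B(d; c) • t = B(d; c, t) + ∑ B(d; c')`, where `c'` runs over the graftings of `t` inside `c`.
An induction on the number of vertices, then on the number of blocks, shows that the one-vertex
trees generate.

For injectivity, the operator on words that deletes a first letter `(k, d)` is again a derivation of
the shuffle product, and on the images of forests it is the removal, in all possible ways, of a root
with decoration `d` and `k` blocks of children. Hence, by induction on the number of vertices, a
combination `P` of rooted forests in the kernel is killed by all root removals. Let `r`, in a forest
`s` of `P`, be a root with the smallest tree among the roots of all forests of `P`. In the forest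
obtained by removing `r` from `s`, the `k` trees that were above `r` are smaller than that of `r`.
If the same forest is obtained from `s'` by removing a root `r'` of the same type, these trees must
be among the `k` trees above `r'`, the others being too large, so that `r' = r` and `s' = s`. In
characteristic zero, the coefficient of `s` in `P` therefore vanishes.
-/

/-! ### The shuffle product and its derivations -/

theorem finsupp_bilinear_ext {R ι κ M : Type*} [CommSemiring R] [AddCommMonoid M] [Module R M]
    {F G : (ι →₀ R) →ₗ[R] (κ →₀ R) →ₗ[R] M}
    (h : ∀ i j, F (Finsupp.single i 1) (Finsupp.single j 1) =
      G (Finsupp.single i 1) (Finsupp.single j 1)) (u : ι →₀ R) (v : κ →₀ R) :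
    F u v = G u v := by
  have hFG : F = G := by
    ext i j
    exact h i j
  rw [hFG]

namespace TensorWords

variable {K : Type v} [Field K] {X : Type w}

theorem single_cons (x : X) (w : List X) :
    (Finsupp.single (x :: w) 1 : TensorWords K X) =
      cons K X (Finsupp.single x 1) (Finsupp.single w 1) := by
  simp [cons]

theorem shuffle_single_single (u v : List X) :
    shuffle K X (Finsupp.single u 1) (Finsupp.single v 1) = shuffleWord K u v := by
  simp [shuffle]

theorem preLie_single_single (f : (X →₀ K) →ₗ[K] (X →₀ K)) (u v : List X) :
    preLie f (Finsupp.single u 1) (Finsupp.single v 1) = preLieWord f u v := by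
  simp [preLie]

theorem shuffle_comm (u v : TensorWords K X) : shuffle K X u v = shuffle K X v u := by
  refine finsupp_bilinear_ext (G := (shuffle K X).flip) (fun u v => ?_) u v
  simp only [LinearMap.flip_apply, shuffle_single_single]
  induction u, v using shuffleWord.induct with
  | case1 v => cases v <;> simp only [shuffleWord]
  | case2 x u => rw [shuffleWord, shuffleWord]
  | case3 x u y v ihu ihv => rw [shuffleWord, shuffleWord, ihu, ihv, add_comm]

@[simp]
theorem nil_shuffle (w : TensorWords K X) : shuffle K X (Finsupp.single [] 1) w = w := by
  have h : shuffle K X (Finsupp.single [] 1) = LinearMap.id :=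
    Finsupp.lhom_ext' fun w => LinearMap.ext_ring (by simp [shuffle_single_single, shuffleWord])
  rw [h, LinearMap.id_apply]

@[simp]
theorem shuffle_nil (w : TensorWords K X) : shuffle K X w (Finsupp.single [] 1) = w := by
  rw [shuffle_comm, nil_shuffle]

theorem cons_shuffle_cons (a b : X →₀ K) (u v : TensorWords K X) :
    shuffle K X (cons K X a u) (cons K X b v) =
      cons K X a (shuffle K X u (cons K X b v)) + cons K X b (shuffle K X (cons K X a u) v) := by
  refine finsupp_bilinear_ext (F := (shuffle K X).compl₁₂ (cons K X a) (cons K X b))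
    (G := ((shuffle K X).compl₂ (cons K X b)).compr₂ (cons K X a) +
      ((shuffle K X).comp (cons K X a)).compr₂ (cons K X b)) (fun u v => ?_) u v
  refine finsupp_bilinear_ext
    (F := (shuffle K X).compl₁₂ ((cons K X).flip (Finsupp.single u 1))
      ((cons K X).flip (Finsupp.single v 1)))
    (G := (cons K X).compl₂ (shuffle K X (Finsupp.single u 1) ∘ₗ
        (cons K X).flip (Finsupp.single v 1)) +
      ((cons K X).compl₂ ((shuffle K X).flip (Finsupp.single v 1) ∘ₗ
        (cons K X).flip (Finsupp.single u 1))).flip) (fun x y => ?_) a b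
  simp only [LinearMap.compl₁₂_apply, LinearMap.add_apply, LinearMap.compl₂_apply,
    LinearMap.flip_apply, LinearMap.comp_apply, ← single_cons, shuffle_single_single, shuffleWord]

theorem nil_preLie (f : (X →₀ K) →ₗ[K] (X →₀ K)) (w : TensorWords K X) :
    preLie f (Finsupp.single [] 1) w = 0 := by
  have h : preLie f (Finsupp.single [] 1) = 0 :=
    Finsupp.lhom_ext' fun w => LinearMap.ext_ring (by simp [preLie_single_single, preLieWord])
  rw [h, LinearMap.zero_apply]

theorem cons_preLie (f : (X →₀ K) →ₗ[K] (X →₀ K)) (a : X →₀ K) (u v : TensorWords K X) :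
    preLie f (cons K X a u) v =
      cons K X a (preLie f u v) + cons K X (f a) (shuffle K X u v) := by
  refine finsupp_bilinear_ext (F := (preLie f).comp (cons K X a))
    (G := (preLie f).compr₂ (cons K X a) + (shuffle K X).compr₂ (cons K X (f a)))
    (fun u v => ?_) u v
  refine LinearMap.congr_fun
    (f := (preLie f).flip (Finsupp.single v 1) ∘ₗ (cons K X).flip (Finsupp.single u 1))
    (g := (cons K X).flip (preLie f (Finsupp.single u 1) (Finsupp.single v 1)) +
      (cons K X).flip (shuffle K X (Finsupp.single u 1) (Finsupp.single v 1)) ∘ₗ f)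
    (Finsupp.lhom_ext' fun x => LinearMap.ext_ring ?_) a
  simp only [LinearMap.comp_apply, LinearMap.flip_apply, LinearMap.add_apply, Finsupp.lsingle_apply,
    ← single_cons, preLie_single_single, shuffle_single_single, preLieWord]

theorem shuffle_assoc (u v w : TensorWords K X) :
    shuffle K X (shuffle K X u v) w = shuffle K X u (shuffle K X v w) := by
  have h : (shuffle K X).compr₂ (shuffle K X) =
      (LinearMap.llcomp K _ _ _).compl₁₂ (shuffle K X) (shuffle K X) := by
    ext u v : 4
    refine Finsupp.lhom_ext' fun w => LinearMap.ext_ring ?_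
    simp only [LinearMap.comp_apply, LinearMap.compr₂_apply, LinearMap.compl₁₂_apply,
      LinearMap.llcomp_apply, Finsupp.lsingle_apply]
    induction u generalizing v w with
    | nil => simp
    | cons x u ihu =>
    induction v generalizing w with
    | nil => simp
    | cons y v ihv =>
    induction w with
    | nil => simp
    | cons z w ihw =>
      have hu := ihu (y :: v) (z :: w)
      have hv := ihv (z :: w)
      simp only [single_cons, cons_shuffle_cons, map_add, LinearMap.add_apply] at hu hv ihw ⊢
      rw [hu, hv]
      simp only [map_add, ← ihw]
      abel
  exact LinearMap.congr_fun (LinearMap.congr_fun₂ h u v) w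

instance : Std.Commutative fun u v : TensorWords K X => shuffle K X u v := ⟨shuffle_comm⟩

instance : Std.Associative fun u v : TensorWords K X => shuffle K X u v := ⟨shuffle_assoc⟩

/-- The shuffle product of a multiset of elements of `T(V)`, the empty word being the unit. -/
noncomputable def shuffleProd (s : Multiset (TensorWords K X)) : TensorWords K X :=
  s.fold (fun u v => shuffle K X u v) (Finsupp.single [] 1)

@[simp]
theorem shuffleProd_zero : shuffleProd (0 : Multiset (TensorWords K X)) = Finsupp.single [] 1 :=
  Multiset.fold_zero _ _

@[simp]
theorem shuffleProd_cons (u : TensorWords K X) (s : Multiset (TensorWords K X)) :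
    shuffleProd (u ::ₘ s) = shuffle K X u (shuffleProd s) :=
  Multiset.fold_cons_left _ _ _ _

theorem shuffleProd_singleton (u : TensorWords K X) : shuffleProd {u} = u := by
  rw [← Multiset.cons_zero, shuffleProd_cons, shuffleProd_zero, shuffle_nil]

theorem shuffleProd_add (s t : Multiset (TensorWords K X)) :
    shuffleProd (s + t) = shuffle K X (shuffleProd s) (shuffleProd t) := by
  induction s using Multiset.induction_on with
  | empty => simp
  | cons u s ih => rw [Multiset.cons_add, shuffleProd_cons, shuffleProd_cons, ih, shuffle_assoc]

/-- A derivation of the shuffle algebra `T(V)`. -/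
def IsShuffleDerivation (δ : TensorWords K X →ₗ[K] TensorWords K X) : Prop :=
  ∀ u v, δ (shuffle K X u v) = shuffle K X (δ u) v + shuffle K X u (δ v)

namespace IsShuffleDerivation

variable {δ : TensorWords K X →ₗ[K] TensorWords K X}

theorem of_words (h : ∀ u v : List X,
      δ (shuffle K X (Finsupp.single u 1) (Finsupp.single v 1)) =
        shuffle K X (δ (Finsupp.single u 1)) (Finsupp.single v 1) +
          shuffle K X (Finsupp.single u 1) (δ (Finsupp.single v 1))) :
    IsShuffleDerivation δ :=
  finsupp_bilinear_ext (F := (shuffle K X).compr₂ δ)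
    (G := (shuffle K X).comp δ + (shuffle K X).compl₂ δ) h

theorem map_nil (hδ : IsShuffleDerivation δ) : δ (Finsupp.single [] 1) = 0 := by
  simpa using hδ (Finsupp.single [] 1) (Finsupp.single [] 1)

open scoped Classical in
theorem map_shuffleProd (hδ : IsShuffleDerivation δ) {ι : Type*} (s : Multiset ι)
    (g : ι → TensorWords K X) :
    δ (shuffleProd (s.map g)) =
      (s.map fun i => shuffle K X (δ (g i)) (shuffleProd ((s.erase i).map g))).sum := by
  induction s using Multiset.induction_on with
  | empty => simp [hδ.map_nil]
  | cons i s ih =>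
    have erase_cons : ∀ j ∈ s, shuffleProd (((i ::ₘ s).erase j).map g) =
        shuffle K X (g i) (shuffleProd ((s.erase j).map g)) := fun j hj => by
      rw [Multiset.erase_cons_tail_of_mem hj, Multiset.map_cons, shuffleProd_cons]
    rw [Multiset.map_cons, shuffleProd_cons, hδ, ih, Multiset.map_cons, Multiset.sum_cons,
      Multiset.erase_cons_head, ← Multiset.sum_hom']
    refine congrArg _ (congrArg _ (Multiset.map_congr rfl fun j hj => ?_))
    rw [erase_cons j hj, ← shuffle_assoc, ← shuffle_assoc, shuffle_comm (g i)]

end IsShuffleDerivation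

theorem isShuffleDerivation_preLie (f : (X →₀ K) →ₗ[K] (X →₀ K)) (w : TensorWords K X) :
    IsShuffleDerivation ((preLie f).flip w) := by
  refine .of_words fun u v => ?_
  simp only [LinearMap.flip_apply]
  induction u generalizing v with
  | nil => simp [nil_preLie]
  | cons x u ihu =>
  induction v with
  | nil => simp [nil_preLie]
  | cons y v ihv =>
    have hu := ihu (y :: v)
    have right_comm (a) : shuffle K X (shuffle K X (Finsupp.single u 1) a) w =
        shuffle K X (shuffle K X (Finsupp.single u 1) w) a := by
      rw [shuffle_assoc, shuffle_comm a, shuffle_assoc]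
    simp only [single_cons] at hu ihv
    simp only [single_cons, cons_shuffle_cons, cons_preLie, map_add, LinearMap.add_apply, hu, ihv,
      right_comm, ← shuffle_assoc]
    abel

/-- The projection of a word to its tail if its first letter is `x`, and to zero otherwise. -/
noncomputable def headDeriv (K : Type v) [Field K] {X : Type w} (x : X) :
    TensorWords K X →ₗ[K] TensorWords K X :=
  Finsupp.lcomapDomain (List.cons x) List.cons_injective

theorem headDeriv_nil (x : X) : headDeriv K x (Finsupp.single [] 1) = 0 := by
  ext w
  simp [headDeriv, Finsupp.lcomapDomain]

open scoped Classical in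
theorem headDeriv_cons (x y : X) (w : TensorWords K X) :
    headDeriv K x (cons K X (Finsupp.single y 1) w) = if x = y then w else 0 := by
  refine LinearMap.congr_fun (f := headDeriv K x ∘ₗ cons K X (Finsupp.single y 1))
    (g := if x = y then LinearMap.id else 0) ?_ w |>.trans (by split_ifs <;> rfl)
  ext u v
  split_ifs with h <;>
    simp [headDeriv, Finsupp.lcomapDomain, cons, Finsupp.single_apply, eq_comm, h]

theorem isShuffleDerivation_headDeriv (x : X) : IsShuffleDerivation (headDeriv K x) := by
  classical
  refine .of_words fun u v => ?_
  cases u with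
  | nil => simp [headDeriv_nil]
  | cons y u =>
  cases v with
  | nil => simp [headDeriv_nil]
  | cons z v =>
    simp only [single_cons, cons_shuffle_cons, map_add, headDeriv_cons]
    split_ifs <;> simp

end TensorWords

/-! ### Partitioned trees as nested multisets -/

theorem PartTree.mk_surjective {D : Type u} : Function.Surjective (PartTree.mk (D := D)) :=
  Quotient.exists_rep

/-- The multiset of the blocks of a list. -/
def PlanarBlocks.blocks {D : Type u} : PlanarBlocks D → Multiset (PartTree D)
  | .nil => 0
  | .cons b F => PartTree.mk b ::ₘ F.blocks

theorem PlanarBlocks.Iso.blocks_eq {D : Type u} {F F' : PlanarBlocks D} (h : F.Iso F') :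
    F.blocks = F'.blocks :=
  match h with
  | .refl _ => rfl
  | .symm h => h.blocks_eq.symm
  | .trans h h' => h.blocks_eq.trans h'.blocks_eq
  | .cons h h' => congrArg₂ _ (Quotient.sound h) h'.blocks_eq
  | .swap _ _ _ => Multiset.cons_swap _ _ _

theorem PlanarBlocks.blocks_surjective {D : Type u} :
    Function.Surjective (PlanarBlocks.blocks (D := D)) := fun c => by
  induction c using Multiset.induction_on with
  | empty => exact ⟨.nil, rfl⟩
  | cons t c ih =>
    obtain ⟨F, rfl⟩ := ih
    obtain ⟨b, rfl⟩ := PartTree.mk_surjective t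
    exact ⟨.cons b F, rfl⟩

namespace PartTree

variable {D : Type u}

instance : LeftCommutative (consBlock (D := D)) := ⟨consBlock_comm⟩

/-- The class of the lists of blocks with given multiset of blocks. -/
def ofBlocks (c : Multiset (PartTree D)) : Quotient (PlanarBlocks.setoid D) :=
  c.foldr consBlock (Quotient.mk _ .nil)

theorem ofBlocks_cons (t : PartTree D) (c : Multiset (PartTree D)) :
    ofBlocks (t ::ₘ c) = consBlock t (ofBlocks c) :=
  Multiset.foldr_cons _ _ _ _

theorem ofBlocks_blocks : (F : PlanarBlocks D) → ofBlocks F.blocks = Quotient.mk _ F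
  | .nil => rfl
  | .cons b F => by
      rw [PlanarBlocks.blocks, ofBlocks_cons, ofBlocks_blocks F]
      rfl

/-- A vertex `(d, c)` of a partitioned tree: its decoration `d` and the multiset `c` of the blocks
of its children, each with everything above it. -/
abbrev Vertex (D : Type u) : Type u := D × Multiset (PartTree D)

/-- The partitioned tree with a single root. -/
def ofRoot (r : Vertex D) : PartTree D := single r.1 (ofBlocks r.2)

theorem mk_single (d : D) (c : PlanarBlocks D) : mk (.single d c) = ofRoot (d, c.blocks) := by
  rw [ofRoot, ofBlocks_blocks]
  rfl

theorem single_merge (d : D) (x : Quotient (PlanarBlocks.setoid D)) (t : PartTree D) :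
    (single d x).merge t = cons d x t := by
  induction x using Quotient.inductionOn
  obtain ⟨b, rfl⟩ := mk_surjective t
  rfl

theorem cons_merge (d : D) (x : Quotient (PlanarBlocks.setoid D)) (t t' : PartTree D) :
    (cons d x t).merge t' = cons d x (t.merge t') := by
  induction x using Quotient.inductionOn
  obtain ⟨b, rfl⟩ := mk_surjective t
  obtain ⟨b', rfl⟩ := mk_surjective t'
  rfl

theorem mk_cons (d : D) (c : PlanarBlocks D) (b : PlanarBlock D) :
    mk (.cons d c b) = (ofRoot (d, c.blocks)).merge (mk b) := by
  rw [ofRoot, single_merge, ofBlocks_blocks]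
  rfl

@[elab_as_elim]
theorem induction_on {P : PartTree D → Prop} (t : PartTree D)
    (ofRoot : ∀ d c, (∀ s ∈ c, P s) → P (ofRoot (d, c)))
    (merge : ∀ s s', P s → P s' → P (s.merge s')) : P t := by
  obtain ⟨b, rfl⟩ := PartTree.mk_surjective t
  refine PlanarBlock.rec (motive_1 := fun b => P (mk b))
    (motive_2 := fun F => ∀ s ∈ F.blocks, P s) (fun d c hc => ?_) (fun d c b hc hb => ?_)
    (fun s hs => ?_) (fun b F hb hF => ?_) b
  · exact mk_single d c ▸ ofRoot d _ hc
  · exact mk_cons d c b ▸ merge _ _ (ofRoot d _ hc) hb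
  · exact absurd hs (Multiset.notMem_zero s)
  · exact Multiset.forall_mem_cons.2 ⟨hb, hF⟩

end PartTree

/-- The multiset of the vertices of a root block. -/
def PlanarBlock.roots {D : Type u} : PlanarBlock D → Multiset (PartTree.Vertex D)
  | .single d c => {(d, c.blocks)}
  | .cons d c b => (d, c.blocks) ::ₘ b.roots

theorem PlanarBlock.Iso.roots_eq {D : Type u} {b b' : PlanarBlock D} (h : b.Iso b') :
    b.roots = b'.roots :=
  match h with
  | .refl _ => rfl
  | .symm h => h.roots_eq.symm
  | .trans h h' => h.roots_eq.trans h'.roots_eq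
  | .single d h => by rw [PlanarBlock.roots, PlanarBlock.roots, h.blocks_eq]
  | .cons d h h' => by rw [PlanarBlock.roots, PlanarBlock.roots, h.blocks_eq, h'.roots_eq]
  | .swapLast _ _ _ _ => Multiset.cons_swap _ _ 0
  | .swap _ _ _ _ _ => Multiset.cons_swap _ _ _

theorem PlanarBlock.roots_merge {D : Type u} (b' : PlanarBlock D) :
    (b : PlanarBlock D) → (b.merge b').roots = b.roots + b'.roots
  | .single _ _ => rfl
  | .cons d c b => by rw [merge, roots, roots, roots_merge b' b, Multiset.cons_add]

namespace PartTree

variable {D : Type u}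

/-- The multiset of the roots of a partitioned tree. -/
def roots : PartTree D → Multiset (Vertex D) :=
  Quotient.lift PlanarBlock.roots fun _ _ h => h.roots_eq

theorem roots_ofRoot (r : Vertex D) : (ofRoot r).roots = {r} := by
  obtain ⟨d, c⟩ := r
  obtain ⟨F, rfl⟩ := PlanarBlocks.blocks_surjective c
  rw [← mk_single]
  rfl

theorem roots_merge (t t' : PartTree D) : (t.merge t').roots = t.roots + t'.roots := by
  obtain ⟨b, rfl⟩ := mk_surjective t
  obtain ⟨b', rfl⟩ := mk_surjective t'
  exact PlanarBlock.roots_merge _ _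

/-- Adding a vertex to a possibly empty root block. -/
def consRoot (r : Vertex D) : Option (PartTree D) → Option (PartTree D)
  | none => some (ofRoot r)
  | some t => some ((ofRoot r).merge t)

instance : LeftCommutative (consRoot (D := D)) where
  left_comm r s b := by
    cases b with
    | none =>
      simp only [consRoot, ofRoot, single_merge]
      exact congrArg some (cons_single_comm _ _ _ _)
    | some t =>
      simp only [consRoot, ofRoot, single_merge]
      exact congrArg some (cons_cons_comm _ _ _ _ _)

theorem foldr_consRoot_roots :
    (b : PlanarBlock D) → b.roots.foldr consRoot none = some (PartTree.mk b)
  | .single d c => by rw [PlanarBlock.roots, Multiset.foldr_singleton, consRoot, mk_single]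
  | .cons d c b => by
      rw [PlanarBlock.roots, Multiset.foldr_cons, foldr_consRoot_roots b, consRoot, mk_cons]

theorem roots_injective : Function.Injective (roots (D := D)) := by
  intro t t' h
  obtain ⟨b, rfl⟩ := PartTree.mk_surjective t
  obtain ⟨b', rfl⟩ := PartTree.mk_surjective t'
  change b.roots = b'.roots at h
  exact Option.some_injective _ <| by
    rw [← foldr_consRoot_roots b, h, foldr_consRoot_roots]

end PartTree

/-! ### Structural recursion on partitioned trees -/

mutual
/-- The value of a planar partitioned tree computed recursively: `v` gives the value of a vertex
from its decoration and the values of the blocks of its children, `op` combines the vertices of a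
block. -/
def PlanarBlock.fold {D : Type u} {M : Type*} (op : M → M → M) (v : D → Multiset M → M) :
    PlanarBlock D → M
  | .single d c => v d (c.fold op v)
  | .cons d c b => op (v d (c.fold op v)) (b.fold op v)
/-- The same for every block of a list. -/
def PlanarBlocks.fold {D : Type u} {M : Type*} (op : M → M → M) (v : D → Multiset M → M) :
    PlanarBlocks D → Multiset M
  | .nil => 0
  | .cons b F => b.fold op v ::ₘ F.fold op v
end

theorem PlanarBlock.fold_merge {D : Type u} {M : Type*} (op : M → M → M) [Std.Associative op]
    (v : D → Multiset M → M) (b' : PlanarBlock D) :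
    (b : PlanarBlock D) → (b.merge b').fold op v = op (b.fold op v) (b'.fold op v)
  | .single _ _ => rfl
  | .cons d c b => by
      rw [merge, fold, fold, fold_merge op v b' b, Std.Associative.assoc (op := op)]

mutual
theorem PlanarBlock.Iso.fold_eq {D : Type u} {M : Type*} (op : M → M → M) [Std.Commutative op]
    [Std.Associative op] (v : D → Multiset M → M) :
    {b b' : PlanarBlock D} → b.Iso b' → b.fold op v = b'.fold op v
  | _, _, .refl _ => rfl
  | _, _, .symm h => (PlanarBlock.Iso.fold_eq op v h).symm
  | _, _, .trans h h' => (PlanarBlock.Iso.fold_eq op v h).trans (PlanarBlock.Iso.fold_eq op v h')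
  | _, _, .single d h => congrArg (v d) (PlanarBlocks.Iso.fold_eq op v h)
  | _, _, .cons d h h' =>
      congrArg₂ op (congrArg (v d) (PlanarBlocks.Iso.fold_eq op v h))
        (PlanarBlock.Iso.fold_eq op v h')
  | _, _, .swapLast _ _ _ _ => Std.Commutative.comm (op := op) _ _
  | _, _, .swap _ _ _ _ _ => LeftCommutative.left_comm (op := op) _ _ _
theorem PlanarBlocks.Iso.fold_eq {D : Type u} {M : Type*} (op : M → M → M) [Std.Commutative op]
    [Std.Associative op] (v : D → Multiset M → M) :
    {F F' : PlanarBlocks D} → F.Iso F' → F.fold op v = F'.fold op v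
  | _, _, .refl _ => rfl
  | _, _, .symm h => (PlanarBlocks.Iso.fold_eq op v h).symm
  | _, _, .trans h h' => (PlanarBlocks.Iso.fold_eq op v h).trans (PlanarBlocks.Iso.fold_eq op v h')
  | _, _, .cons h h' =>
      congrArg₂ Multiset.cons (PlanarBlock.Iso.fold_eq op v h) (PlanarBlocks.Iso.fold_eq op v h')
  | _, _, .swap _ _ _ => Multiset.cons_swap _ _ _
end

namespace PartTree

variable {D : Type u} {M : Type*} (op : M → M → M) [Std.Commutative op] [Std.Associative op]
  (v : D → Multiset M → M)

/-- Structural recursion on partitioned trees, see `PlanarBlock.fold`. -/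
def fold : PartTree D → M :=
  Quotient.lift (PlanarBlock.fold op v) fun _ _ h => h.fold_eq op v

theorem map_fold_blocks : (F : PlanarBlocks D) → F.blocks.map (fold op v) = F.fold op v
  | .nil => rfl
  | .cons _ F => (Multiset.map_cons _ _ _).trans (congrArg _ (map_fold_blocks F))

theorem fold_ofRoot (r : Vertex D) : fold op v (ofRoot r) = v r.1 (r.2.map (fold op v)) := by
  obtain ⟨d, c⟩ := r
  obtain ⟨F, rfl⟩ := PlanarBlocks.blocks_surjective c
  rw [← mk_single, map_fold_blocks]
  rfl

theorem fold_merge (t t' : PartTree D) :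
    fold op v (t.merge t') = op (fold op v t) (fold op v t') := by
  obtain ⟨b, rfl⟩ := mk_surjective t
  obtain ⟨b', rfl⟩ := mk_surjective t'
  exact PlanarBlock.fold_merge op v _ _

end PartTree

/-! ### Grafting -/

namespace PartTree

variable {D : Type u}

open scoped Classical in
/-- The multisets of blocks obtained from `c` by grafting `t` on a vertex of one of the blocks. -/
noncomputable def graftBlocks (c : Multiset (PartTree D)) (t : PartTree D) :
    Multiset (Multiset (PartTree D)) :=
  c.bind fun s => (s.graft t).map fun s' => s' ::ₘ c.erase s

theorem graftBlocks_cons (s : PartTree D) (c : Multiset (PartTree D)) (t : PartTree D) :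
    graftBlocks (s ::ₘ c) t =
      (s.graft t).map (fun s' => s' ::ₘ c) + (graftBlocks c t).map (s ::ₘ ·) := by
  classical
  rw [graftBlocks, graftBlocks, Multiset.cons_bind, Multiset.erase_cons_head, Multiset.map_bind]
  refine congrArg _ (Multiset.bind_congr fun r hr => ?_)
  rw [Multiset.erase_cons_tail_of_mem hr, Multiset.map_map]
  exact Multiset.map_congr rfl fun s' _ => Multiset.cons_swap _ _ _

theorem graftClass_eq_map_graftBlocks (b : PlanarBlock D) : (F : PlanarBlocks D) →
    PlanarBlocks.graftClass b F = (graftBlocks F.blocks (mk b)).map ofBlocks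
  | .nil => rfl
  | .cons a F => by
      rw [PlanarBlocks.graftClass_cons, graftClass_eq_map_graftBlocks b F, PlanarBlocks.blocks,
        graftBlocks_cons, Multiset.map_add, Multiset.map_map, Multiset.map_map, Multiset.map_map]
      simp only [Function.comp_def, ofBlocks_cons, ofBlocks_blocks]
      rfl

theorem graft_ofRoot (d : D) (c : Multiset (PartTree D)) (t : PartTree D) :
    (ofRoot (d, c)).graft t =
      ofRoot (d, t ::ₘ c) ::ₘ (graftBlocks c t).map fun c' => ofRoot (d, c') := by
  obtain ⟨F, rfl⟩ := PlanarBlocks.blocks_surjective c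
  obtain ⟨b, rfl⟩ := mk_surjective t
  rw [← mk_single]
  change PlanarBlock.graftClass b (.single d F) = _
  rw [PlanarBlock.graftClass_single, graftClass_eq_map_graftBlocks, Multiset.map_map,
    Multiset.singleton_add, ofRoot, ofBlocks_cons, ofBlocks_blocks]
  rfl

theorem graftClass_merge (t b' : PlanarBlock D) : (b : PlanarBlock D) →
    PlanarBlock.graftClass t (b.merge b') =
      (PlanarBlock.graftClass t b).map (·.merge (mk b')) +
        (PlanarBlock.graftClass t b').map ((mk b).merge ·)
  | .single d c => by
      rw [PlanarBlock.merge, PlanarBlock.graftClass_cons, PlanarBlock.graftClass_single,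
        Multiset.map_add, Multiset.map_singleton, Multiset.map_map]
      simp only [Function.comp_def, single_merge]
      rfl
  | .cons d c b => by
      have mk_cons_merge (x : PartTree D) : (mk (.cons d c b)).merge x =
          cons d (Quotient.mk _ c) ((mk b).merge x) := cons_merge d (Quotient.mk _ c) (mk b) x
      rw [PlanarBlock.merge, PlanarBlock.graftClass_cons, PlanarBlock.graftClass_cons,
        graftClass_merge t b' b, Multiset.map_add, Multiset.map_add, Multiset.map_add,
        Multiset.map_singleton, Multiset.map_map, Multiset.map_map, Multiset.map_map,
        Multiset.map_map, add_assoc, add_assoc, add_assoc]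
      simp only [Function.comp_def, cons_merge, mk_cons_merge]
      rfl

theorem graft_merge (s s' t : PartTree D) :
    (s.merge s').graft t = (s.graft t).map (·.merge s') + (s'.graft t).map (s.merge ·) := by
  obtain ⟨a, rfl⟩ := mk_surjective s
  obtain ⟨a', rfl⟩ := mk_surjective s'
  obtain ⟨b, rfl⟩ := mk_surjective t
  exact graftClass_merge b a' a

theorem exists_mem_of_mem_graftBlocks {c c' : Multiset (PartTree D)} {t : PartTree D}
    (h : c' ∈ graftBlocks c t) :
    ∃ s ∈ c, ∃ s' ∈ s.graft t, ∃ c₀, c = s ::ₘ c₀ ∧ c' = s' ::ₘ c₀ := by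
  classical
  obtain ⟨s, hs, h⟩ := Multiset.mem_bind.1 h
  obtain ⟨s', hs', rfl⟩ := Multiset.mem_map.1 h
  exact ⟨s, hs, s', hs', c.erase s, (Multiset.cons_erase hs).symm, rfl⟩

theorem card_of_mem_graftBlocks {c c' : Multiset (PartTree D)} {t : PartTree D}
    (h : c' ∈ graftBlocks c t) : Multiset.card c' = Multiset.card c := by
  obtain ⟨s, -, s', -, c₀, rfl, rfl⟩ := exists_mem_of_mem_graftBlocks h
  rw [Multiset.card_cons, Multiset.card_cons]

/-! ### Rooted trees -/

theorem isRootedTree_of_mem_blocks : {F : PlanarBlocks D} → F.AreRootedTrees →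
    ∀ t ∈ F.blocks, t.IsRootedTree
  | .nil, _ => fun t ht => absurd ht (Multiset.notMem_zero t)
  | .cons b _, hF => Multiset.forall_mem_cons.2 ⟨⟨b, hF.1, rfl⟩, isRootedTree_of_mem_blocks hF.2⟩

theorem IsRootedTree.exists_eq_ofRoot {t : PartTree D} (ht : t.IsRootedTree) :
    ∃ r : Vertex D, t = ofRoot r ∧ ∀ s ∈ r.2, s.IsRootedTree := by
  obtain ⟨b, hb, rfl⟩ := ht
  cases b with
  | single d c => exact ⟨(d, c.blocks), mk_single d c, isRootedTree_of_mem_blocks hb⟩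
  | cons => exact hb.elim

/-! ### The number of vertices -/

/-- The number of vertices of a partitioned tree. -/
def size : PartTree D → ℕ := fold (· + ·) fun _ m => 1 + m.sum

theorem size_ofRoot (r : Vertex D) : (ofRoot r).size = 1 + (r.2.map size).sum :=
  fold_ofRoot _ _ _

theorem size_merge (t t' : PartTree D) : (t.merge t').size = t.size + t'.size :=
  fold_merge _ _ _ _

theorem size_of_mem_graft {s t t' : PartTree D} (h : s ∈ t.graft t') :
    s.size = t.size + t'.size := by
  induction t using PartTree.induction_on generalizing s with
  | ofRoot d c ih =>
    rw [graft_ofRoot, Multiset.mem_cons, Multiset.mem_map] at h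
    obtain rfl | ⟨c', hc', rfl⟩ := h
    · simp only [size_ofRoot, Multiset.map_cons, Multiset.sum_cons]
      ring
    · obtain ⟨a, ha, a', ha', c₀, rfl, rfl⟩ := exists_mem_of_mem_graftBlocks hc'
      simp only [size_ofRoot, Multiset.map_cons, Multiset.sum_cons, ih a ha ha']
      ring
  | merge a a' ih ih' =>
    rw [graft_merge, Multiset.mem_add, Multiset.mem_map, Multiset.mem_map] at h
    obtain ⟨b, hb, rfl⟩ | ⟨b, hb, rfl⟩ := h
    · rw [size_merge, size_merge, ih hb, add_right_comm]
    · rw [size_merge, size_merge, ih' hb, add_assoc]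

end PartTree

/-! ### The morphism from partitioned trees to biwords -/

namespace PartTree

variable (K : Type v) [Field K] {D : Type u}

open TensorWords

/-- The image of a partitioned tree under `Φ_CPL`. The index of the biletter of a vertex is the
number of its blocks of children. -/
noncomputable def biword : PartTree D → Biwords K D :=
  fold (fun u v => shuffle K (ℕ × D) u v) fun d m =>
    TensorWords.cons K (ℕ × D) (Finsupp.single (Multiset.card m, d) 1) (shuffleProd m)

theorem biword_ofRoot (r : Vertex D) :
    (ofRoot r).biword K = TensorWords.cons K (ℕ × D) (Finsupp.single (Multiset.card r.2, r.1) 1)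
      (shuffleProd (r.2.map (biword K))) := by
  rw [biword, fold_ofRoot, Multiset.card_map]

theorem biword_merge (t t' : PartTree D) :
    (t.merge t').biword K = shuffle K (ℕ × D) (t.biword K) (t'.biword K) :=
  fold_merge _ _ _ _

theorem sum_shuffleProd_graftBlocks (c : Multiset (PartTree D)) (t : PartTree D)
    (hc : ∀ s ∈ c, ((s.graft t).map (biword K)).sum =
      preLie (biletterShift K D) (s.biword K) (t.biword K)) :
    ((graftBlocks c t).map fun c' => shuffleProd (c'.map (biword K))).sum =
      preLie (biletterShift K D) (shuffleProd (c.map (biword K))) (t.biword K) := by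
  classical
  have leibniz := (isShuffleDerivation_preLie (biletterShift K D) (t.biword K)).map_shuffleProd c
    (biword K)
  rw [LinearMap.flip_apply] at leibniz
  rw [leibniz, graftBlocks, Multiset.map_bind, Multiset.sum_bind]
  refine congrArg _ (Multiset.map_congr rfl fun s hs => ?_)
  rw [LinearMap.flip_apply, ← hc s hs, Multiset.map_map]
  simp only [Function.comp_def, Multiset.map_cons, shuffleProd_cons]
  exact Multiset.sum_hom' (s.graft t)
    ((shuffle K (ℕ × D)).flip (shuffleProd ((c.erase s).map (biword K)))) (biword K)

theorem sum_biword_graft (s t : PartTree D) :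
    ((s.graft t).map (biword K)).sum =
      preLie (biletterShift K D) (s.biword K) (t.biword K) := by
  induction s using PartTree.induction_on with
  | ofRoot d c ih =>
    have biword_graftBlocks : ∀ c' ∈ graftBlocks c t, (ofRoot (d, c')).biword K =
        TensorWords.cons K (ℕ × D) (Finsupp.single (Multiset.card c, d) 1)
          (shuffleProd (c'.map (biword K))) :=
      fun c' hc' => by rw [biword_ofRoot, card_of_mem_graftBlocks hc']
    have shift_single : biletterShift K D (Finsupp.single (Multiset.card c, d) 1) =
        Finsupp.single (Multiset.card c + 1, d) 1 := by simp [biletterShift]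
    rw [graft_ofRoot, Multiset.map_cons, Multiset.sum_cons, Multiset.map_map, Function.comp_def,
      Multiset.map_congr rfl biword_graftBlocks, Multiset.sum_hom',
      sum_shuffleProd_graftBlocks K c t ih, biword_ofRoot, biword_ofRoot, cons_preLie, shift_single,
      Multiset.map_cons, shuffleProd_cons, Multiset.card_cons, shuffle_comm (t.biword K), add_comm]
  | merge s s' ih ih' =>
    have leibniz := isShuffleDerivation_preLie (biletterShift K D) (t.biword K) (s.biword K)
      (s'.biword K)
    simp only [LinearMap.flip_apply, ← ih, ← ih'] at leibniz
    rw [graft_merge, Multiset.map_add, Multiset.sum_add, Multiset.map_map, Multiset.map_map,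
      biword_merge, leibniz]
    simp only [Function.comp_def, biword_merge]
    exact congrArg₂ (· + ·)
      (Multiset.sum_hom' (s.graft t) ((shuffle K (ℕ × D)).flip (s'.biword K)) (biword K))
      (Multiset.sum_hom' (s'.graft t) (shuffle K (ℕ × D) (s.biword K)) (biword K))

end PartTree

namespace ComPrelie

variable {K : Type v} [Field K] {D : Type u}

theorem shuffle_single_single (t t' : PartTree D) :
    shuffle K D (Finsupp.single t 1) (Finsupp.single t' 1) = Finsupp.single (t.merge t') 1 := by
  simp [shuffle]

theorem preLie_single_single (t t' : PartTree D) :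
    preLie K D (Finsupp.single t 1) (Finsupp.single t' 1) =
      ((t.graft t').map fun s => Finsupp.single s (1 : K)).sum := by
  simp [preLie]

variable (K D) in
/-- The morphism `Φ_CPL` of Com-Pre-Lie algebras, given on the basis by `PartTree.biword`. -/
noncomputable def toBiwords : ComPrelie K D →ₗ[K] Biwords K D :=
  Finsupp.linearCombination K (PartTree.biword K)

theorem toBiwords_single (t : PartTree D) : toBiwords K D (Finsupp.single t 1) = t.biword K := by
  simp [toBiwords]

variable (K D) in
theorem isPhiCPL_toBiwords : IsPhiCPL (toBiwords K D) where
  map_shuffle := finsupp_bilinear_ext (F := (shuffle K D).compr₂ (toBiwords K D))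
    (G := (TensorWords.shuffle K (ℕ × D)).compl₁₂ (toBiwords K D) (toBiwords K D)) fun t t' => by
      simp only [LinearMap.compr₂_apply, LinearMap.compl₁₂_apply, shuffle_single_single,
        toBiwords_single, PartTree.biword_merge]
  map_preLie := finsupp_bilinear_ext (F := (preLie K D).compr₂ (toBiwords K D))
    (G := (TensorWords.preLie (biletterShift K D)).compl₁₂ (toBiwords K D) (toBiwords K D))
    fun t t' => by
      simp only [LinearMap.compr₂_apply, LinearMap.compl₁₂_apply, preLie_single_single,
        ← Multiset.sum_hom', toBiwords_single, PartTree.sum_biword_graft]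
  map_dot d := by
    have dot_eq : PartTree.dot d = PartTree.ofRoot (d, 0) := rfl
    rw [dot, toBiwords_single, dot_eq, PartTree.biword_ofRoot, Multiset.map_zero,
      TensorWords.shuffleProd_zero, ← TensorWords.single_cons, Multiset.card_zero, biletter]

end ComPrelie

/-! ### Generation by the one-vertex trees, and uniqueness of the morphisms -/

section Generation

variable {K : Type v} [Field K] {D : Type u}

open PartTree

theorem ComPrelie.single_ofRoot_cons (d : D) (t : PartTree D) (c : Multiset (PartTree D)) :
    (Finsupp.single (ofRoot (d, t ::ₘ c)) 1 : ComPrelie K D) =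
      preLie K D (Finsupp.single (ofRoot (d, c)) 1) (Finsupp.single t 1) -
        ((graftBlocks c t).map fun c' => Finsupp.single (ofRoot (d, c')) (1 : K)).sum := by
  rw [preLie_single_single, graft_ofRoot, Multiset.map_cons, Multiset.sum_cons, Multiset.map_map]
  exact (add_sub_cancel_right _ _).symm

variable {S : Submodule K (ComPrelie K D)} (hdot : ∀ d, ComPrelie.dot K d ∈ S)
  (hpreLie : ∀ x ∈ S, ∀ y ∈ S, ComPrelie.preLie K D x y ∈ S)

include hdot hpreLie

theorem ComPrelie.single_ofRoot_mem {A : PartTree D → Prop}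
    (hA : ∀ t t', A t → A t' → ∀ s ∈ t.graft t', A s) {n : ℕ}
    (hn : ∀ t, A t → t.size < n → Finsupp.single t 1 ∈ S) (d : D) {c : Multiset (PartTree D)}
    (hc : ∀ t ∈ c, A t) (hsize : (ofRoot (d, c)).size ≤ n) :
    Finsupp.single (ofRoot (d, c)) 1 ∈ S := by
  induction hk : Multiset.card c generalizing c with
  | zero =>
    obtain rfl := Multiset.card_eq_zero.1 hk
    exact hdot d
  | succ k ih =>
    obtain ⟨t, ht⟩ := (Multiset.card_pos_iff_exists_mem (s := c)).1 (by lia)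
    obtain ⟨c, rfl⟩ := Multiset.exists_cons_of_mem ht
    replace ⟨ht, hc⟩ := Multiset.forall_mem_cons.1 hc
    have hk : Multiset.card c = k := by simpa using hk
    have size_graft : (ofRoot (d, c)).size + t.size ≤ n := by
      simp only [size_ofRoot, Multiset.map_cons, Multiset.sum_cons] at hsize ⊢
      lia
    have size_pos : 0 < (ofRoot (d, c)).size := by
      rw [size_ofRoot]
      lia
    rw [single_ofRoot_cons]
    refine S.sub_mem (hpreLie _ (ih hc (by lia) hk) _ (hn t ht (by lia)))
      (multiset_sum_mem _ fun x hx => ?_)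
    obtain ⟨c', hc', rfl⟩ := Multiset.mem_map.1 hx
    have size_eq : (ofRoot (d, c')).size = (ofRoot (d, c)).size + t.size := by
      refine size_of_mem_graft ?_
      rw [graft_ofRoot]
      exact Multiset.mem_cons_of_mem (Multiset.mem_map_of_mem _ hc')
    refine ih ?_ (size_eq.trans_le size_graft) ((card_of_mem_graftBlocks hc').trans hk)
    obtain ⟨s, hs, s', hs', c₀, rfl, rfl⟩ := exists_mem_of_mem_graftBlocks hc'
    obtain ⟨hs, hc₀⟩ := Multiset.forall_mem_cons.1 hc
    exact Multiset.forall_mem_cons.2 ⟨hA s t hs ht s' hs', hc₀⟩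

theorem Prelie.le_of_preLie_closed : Prelie K D ≤ S := by
  have single_mem (n : ℕ) : ∀ t : PartTree D, t.IsRootedTree → t.size < n →
      Finsupp.single t 1 ∈ S := by
    induction n with
    | zero => exact fun t _ h => absurd h (Nat.not_lt_zero _)
    | succ n ih =>
      intro t ht hsize
      obtain ⟨⟨d, c⟩, rfl, hc⟩ := ht.exists_eq_ofRoot
      exact ComPrelie.single_ofRoot_mem hdot hpreLie (fun _ _ => IsRootedTree.graft) ih d hc
        (Nat.le_of_lt_succ hsize)
  refine Submodule.span_le.2 ?_
  rintro _ ⟨t, ht, rfl⟩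
  exact single_mem (t.size + 1) t ht t.size.lt_succ_self

theorem ComPrelie.eq_top_of_closed
    (hshuffle : ∀ x ∈ S, ∀ y ∈ S, ComPrelie.shuffle K D x y ∈ S) : S = ⊤ := by
  have single_mem (n : ℕ) : ∀ t : PartTree D, t.size < n → Finsupp.single t 1 ∈ S := by
    induction n with
    | zero => exact fun t h => absurd h (Nat.not_lt_zero _)
    | succ n ih =>
      intro t hsize
      induction t using PartTree.induction_on with
      | ofRoot d c _ =>
        exact single_ofRoot_mem hdot hpreLie (A := fun _ => True) (fun _ _ _ _ _ _ => trivial)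
          (fun t _ => ih t) d (fun _ _ => trivial) (Nat.le_of_lt_succ hsize)
      | merge s s' hs hs' =>
        rw [size_merge] at hsize
        rw [← shuffle_single_single]
        exact hshuffle _ (hs (by lia)) _ (hs' (by lia))
  refine Submodule.eq_top_iff'.2 fun x => x.induction_linear S.zero_mem
    (fun _ _ => S.add_mem) fun t a => ?_
  rw [← mul_one a, ← smul_eq_mul, ← Finsupp.smul_single]
  exact S.smul_mem a (single_mem (t.size + 1) t t.size.lt_succ_self)

end Generation

section Uniqueness

variable {K : Type v} [Field K] {D : Type u}

theorem IsPhiCPL.ext {Φ Ψ : ComPrelie K D →ₗ[K] Biwords K D} (hΦ : IsPhiCPL Φ)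
    (hΨ : IsPhiCPL Ψ) : Φ = Ψ := by
  refine LinearMap.eqLocus_eq_top.1 (ComPrelie.eq_top_of_closed (fun d => ?_)
    (fun x hx y hy => ?_) fun x hx y hy => ?_)
  · exact (hΦ.map_dot d).trans (hΨ.map_dot d).symm
  · rw [LinearMap.mem_eqLocus] at *
    rw [hΦ.map_preLie, hΨ.map_preLie, hx, hy]
  · rw [LinearMap.mem_eqLocus] at *
    rw [hΦ.map_shuffle, hΨ.map_shuffle, hx, hy]

theorem IsPhiPL.ext {φ ψ : Prelie K D →ₗ[K] Biwords K D} (hφ : IsPhiPL φ) (hψ : IsPhiPL ψ) :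
    φ = ψ := by
  have hle : Prelie K D ≤ (LinearMap.eqLocus φ ψ).map (Prelie K D).subtype := by
    refine Prelie.le_of_preLie_closed (fun d => ?_) ?_
    · exact ⟨Prelie.dot K d, (hφ.map_dot d).trans (hψ.map_dot d).symm, rfl⟩
    · rintro _ ⟨x, hx, rfl⟩ _ ⟨y, hy, rfl⟩
      refine ⟨Prelie.preLie x y, ?_, rfl⟩
      rw [SetLike.mem_coe, LinearMap.mem_eqLocus] at *
      rw [hφ.map_preLie, hψ.map_preLie, hx, hy]
  ext1 x
  obtain ⟨y, hy, hyx⟩ := hle x.2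
  rw [← Subtype.ext hyx]
  exact hy

theorem IsPhiCPL.domRestrict {Φ : ComPrelie K D →ₗ[K] Biwords K D} (hΦ : IsPhiCPL Φ) :
    IsPhiPL (Φ.domRestrict (Prelie K D)) where
  map_preLie x y := hΦ.map_preLie x y
  map_dot d := hΦ.map_dot d

end Uniqueness

/-! ### Forests and the removal of roots -/

namespace PartTree

variable {D : Type u}

open scoped Classical in
/-- The forest obtained from `s` by removing the root `r`, whose children become roots. A forest is
given by the multiset of its roots; its root block is allowed to be empty. -/
noncomputable def removeRoot (s : Multiset (Vertex D)) (r : Vertex D) : Multiset (Vertex D) :=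
  s.erase r + r.2.bind roots

open scoped Classical in
/-- The forests obtained from `s` by removing a root with `p.1` blocks of children and with
decoration `p.2`. -/
noncomputable def rootRemovals (p : ℕ × D) (s : Multiset (Vertex D)) :
    Multiset (Multiset (Vertex D)) :=
  s.bind fun r => if p = (Multiset.card r.2, r.1) then {removeRoot s r} else 0

theorem mem_rootRemovals {p : ℕ × D} {s u : Multiset (Vertex D)} :
    u ∈ rootRemovals p s ↔ ∃ r ∈ s, p = (Multiset.card r.2, r.1) ∧ u = removeRoot s r := by
  classical
  refine Multiset.mem_bind.trans (exists_congr fun r => and_congr_right fun _ => ?_)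
  split_ifs with h <;> simp [h]

/-- The number of vertices of a forest. -/
def weight (s : Multiset (Vertex D)) : ℕ := (s.map fun r => (ofRoot r).size).sum

theorem weight_add (s s' : Multiset (Vertex D)) : weight (s + s') = weight s + weight s' := by
  rw [weight, Multiset.map_add, Multiset.sum_add, ← weight, ← weight]

theorem size_le_weight {s : Multiset (Vertex D)} {r : Vertex D} (hr : r ∈ s) :
    (ofRoot r).size ≤ weight s :=
  Multiset.le_sum_of_mem (Multiset.mem_map_of_mem (fun r => (ofRoot r).size) hr)

theorem weight_roots (t : PartTree D) : weight t.roots = t.size := by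
  induction t using PartTree.induction_on with
  | ofRoot d c _ => rw [roots_ofRoot, weight, Multiset.map_singleton, Multiset.sum_singleton]
  | merge s s' ih ih' => rw [roots_merge, weight_add, ih, ih', size_merge]

theorem size_ofRoot_eq_weight (r : Vertex D) : (ofRoot r).size = 1 + weight (r.2.bind roots) := by
  rw [size_ofRoot, weight, Multiset.map_bind, Multiset.sum_bind]
  exact congrArg _ (congrArg _ (Multiset.map_congr rfl fun t _ => (weight_roots t).symm))

theorem weight_removeRoot {s : Multiset (Vertex D)} {r : Vertex D} (hr : r ∈ s) :
    weight (removeRoot s r) + 1 = weight s := by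
  classical
  have weight_erase : weight s = (ofRoot r).size + weight (s.erase r) := by
    conv_lhs => rw [← Multiset.cons_erase hr, weight, Multiset.map_cons, Multiset.sum_cons]
    rfl
  rw [weight_erase, size_ofRoot_eq_weight, removeRoot, weight_add]
  ring

theorem bind_roots_le_filter_removeRoot (s : Multiset (Vertex D)) (r : Vertex D) :
    r.2.bind roots ≤ (removeRoot s r).filter fun q => (ofRoot q).size < (ofRoot r).size := by
  refine Multiset.le_filter.2 ⟨Multiset.le_add_left _ _, fun q hq => ?_⟩
  rw [size_ofRoot_eq_weight r]
  exact Nat.lt_one_add_iff.2 (size_le_weight hq)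

theorem filter_removeRoot_le {s : Multiset (Vertex D)} {n : ℕ} (h : ∀ q ∈ s, n ≤ (ofRoot q).size)
    (r : Vertex D) : (removeRoot s r).filter (fun q => (ofRoot q).size < n) ≤ r.2.bind roots := by
  classical
  have filter_erase : (s.erase r).filter (fun q => (ofRoot q).size < n) = 0 :=
    Multiset.filter_eq_nil.2 fun q hq => (h q (Multiset.mem_of_mem_erase hq)).not_gt
  rw [removeRoot, Multiset.filter_add, filter_erase, zero_add]
  exact Multiset.filter_le _ _

/-- The forests of rooted trees: all blocks but the root block have cardinality one. -/
def IsRootedForest (s : Multiset (Vertex D)) : Prop := ∀ r ∈ s, ∀ t ∈ r.2, t.IsRootedTree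

theorem IsRootedTree.isRootedForest_roots {t : PartTree D} (h : t.IsRootedTree) :
    IsRootedForest t.roots := by
  obtain ⟨r, rfl, hr⟩ := h.exists_eq_ofRoot
  rw [roots_ofRoot]
  exact fun q hq => Multiset.mem_singleton.1 hq ▸ hr

theorem map_ofRoot_bind_roots {c : Multiset (PartTree D)} (hc : ∀ t ∈ c, t.IsRootedTree) :
    (c.bind roots).map ofRoot = c := by
  have map_roots : ∀ t ∈ c, t.roots.map ofRoot = {t} := fun t ht => by
    obtain ⟨r, rfl, -⟩ := (hc t ht).exists_eq_ofRoot
    rw [roots_ofRoot, Multiset.map_singleton]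
  rw [Multiset.map_bind, Multiset.bind_congr map_roots, Multiset.bind_singleton, Multiset.map_id']

namespace IsRootedForest

variable {s s' : Multiset (Vertex D)} {r r' : Vertex D}

theorem add (h : IsRootedForest s) (h' : IsRootedForest s') : IsRootedForest (s + s') :=
  fun r hr => (Multiset.mem_add.1 hr).elim (h r) (h' r)

theorem removeRoot (h : IsRootedForest s) (hr : r ∈ s) : IsRootedForest (removeRoot s r) := by
  classical
  refine .add (fun q hq => h q (Multiset.mem_of_mem_erase hq)) fun q hq => ?_
  obtain ⟨t, ht, hq⟩ := Multiset.mem_bind.1 hq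
  exact (h r hr t ht).isRootedForest_roots q hq

theorem eq_of_removeRoot_eq (h : IsRootedForest s) (h' : IsRootedForest s') (hr : r ∈ s)
    (hr' : r' ∈ s') (hmin : ∀ q ∈ s', (ofRoot r).size ≤ (ofRoot q).size)
    (htype : (Multiset.card r.2, r.1) = (Multiset.card r'.2, r'.1))
    (heq : PartTree.removeRoot s r = PartTree.removeRoot s' r') : s = s' := by
  classical
  obtain ⟨hcard, hdec⟩ := Prod.mk.inj htype
  -- The trees of the common forest that are smaller than that of `r` contain all those above `r`
  -- and are all above `r'`.
  have hle : r.2.bind roots ≤ r'.2.bind roots :=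
    (bind_roots_le_filter_removeRoot s r).trans (heq ▸ filter_removeRoot_le hmin r')
  have children_le : r.2 ≤ r'.2 := by
    rw [← map_ofRoot_bind_roots (h r hr), ← map_ofRoot_bind_roots (h' r' hr')]
    exact Multiset.map_le_map hle
  obtain rfl : r = r' := Prod.ext hdec (Multiset.eq_of_le_of_card_le children_le hcard.ge)
  rw [← Multiset.cons_erase hr, ← Multiset.cons_erase hr', add_right_cancel heq]

end IsRootedForest

end PartTree

/-! ### Biwords of forests -/

namespace PartTree

variable (K : Type v) [Field K] {D : Type u}

open TensorWords

/-- The image in `T(V_D, f_D)` of a forest given by the multiset of its roots. -/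
noncomputable def forestBiword (s : Multiset (Vertex D)) : Biwords K D :=
  shuffleProd (s.map fun r => (ofRoot r).biword K)

theorem forestBiword_add (s s' : Multiset (Vertex D)) :
    forestBiword K (s + s') = shuffle K (ℕ × D) (forestBiword K s) (forestBiword K s') := by
  rw [forestBiword, Multiset.map_add, shuffleProd_add, ← forestBiword, ← forestBiword]

theorem forestBiword_roots (t : PartTree D) : forestBiword K t.roots = t.biword K := by
  induction t using PartTree.induction_on with
  | ofRoot d c _ => rw [roots_ofRoot, forestBiword, Multiset.map_singleton, shuffleProd_singleton]
  | merge s s' ih ih' => rw [roots_merge, forestBiword_add, ih, ih', biword_merge]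

theorem forestBiword_bind_roots (c : Multiset (PartTree D)) :
    forestBiword K (c.bind roots) = shuffleProd (c.map (biword K)) := by
  induction c using Multiset.induction_on with
  | empty => rfl
  | cons t c ih =>
    rw [Multiset.cons_bind, forestBiword_add, ih, forestBiword_roots, Multiset.map_cons,
      shuffleProd_cons]

theorem headDeriv_forestBiword (p : ℕ × D) (s : Multiset (Vertex D)) :
    headDeriv K p (forestBiword K s) = ((rootRemovals p s).map (forestBiword K)).sum := by
  classical
  rw [forestBiword, (isShuffleDerivation_headDeriv p).map_shuffleProd, rootRemovals,
    Multiset.map_bind, Multiset.sum_bind]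
  refine congrArg _ (Multiset.map_congr rfl fun r _ => ?_)
  rw [biword_ofRoot, headDeriv_cons, ← forestBiword_bind_roots, ← forestBiword]
  split_ifs
  · rw [Multiset.map_singleton, Multiset.sum_singleton, shuffle_comm, ← forestBiword_add,
      removeRoot]
    congr!
  · rw [Multiset.map_zero, Multiset.sum_zero, map_zero, LinearMap.zero_apply]

/-! ### Injectivity on forests of rooted trees -/

/-- The image of a forest in `T(V_D, f_D)`, extended linearly. -/
noncomputable def forestToBiwords (K : Type v) [Field K] (D : Type u) :
    (Multiset (Vertex D) →₀ K) →ₗ[K] Biwords K D :=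
  Finsupp.linearCombination K (forestBiword K)

/-- The linear operator that maps a forest to the sum of the forests obtained by removing a root of
type `p`. -/
noncomputable def rootDeriv (p : ℕ × D) :
    (Multiset (Vertex D) →₀ K) →ₗ[K] (Multiset (Vertex D) →₀ K) :=
  Finsupp.linearCombination K fun s => ((rootRemovals p s).map (Finsupp.single · (1 : K))).sum

variable {K}

theorem forestToBiwords_single (s : Multiset (Vertex D)) (a : K) :
    forestToBiwords K D (Finsupp.single s a) = a • forestBiword K s :=
  Finsupp.linearCombination_single _ _ _

theorem forestToBiwords_rootDeriv (p : ℕ × D) (P : Multiset (Vertex D) →₀ K) :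
    forestToBiwords K D (rootDeriv K p P) = headDeriv K p (forestToBiwords K D P) := by
  refine LinearMap.congr_fun (f := forestToBiwords K D ∘ₗ rootDeriv K p)
    (g := headDeriv K p ∘ₗ forestToBiwords K D)
    (Finsupp.lhom_ext' fun s => LinearMap.ext_ring ?_) P
  simp only [LinearMap.comp_apply, Finsupp.lsingle_apply, rootDeriv,
    Finsupp.linearCombination_single, one_smul, forestToBiwords_single, headDeriv_forestBiword,
    ← Multiset.sum_hom']

theorem forestToBiwords_mapDomain_roots (x : ComPrelie K D) :
    forestToBiwords K D (x.mapDomain roots) = ComPrelie.toBiwords K D x := by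
  rw [forestToBiwords, Finsupp.linearCombination_mapDomain, ComPrelie.toBiwords]
  congr 2
  exact funext (forestBiword_roots K)

theorem rootDeriv_mem_supported (p : ℕ × D) {N : ℕ} {P : Multiset (Vertex D) →₀ K}
    (hP : P ∈ Finsupp.supported K K {s | IsRootedForest s ∧ weight s < N + 1}) :
    rootDeriv K p P ∈ Finsupp.supported K K {s | IsRootedForest s ∧ weight s < N} := by
  rw [rootDeriv, Finsupp.linearCombination_apply]
  refine Submodule.sum_mem _ fun s hs => Submodule.smul_mem _ _ (multiset_sum_mem _ fun x hx => ?_)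
  obtain ⟨u, hu, rfl⟩ := Multiset.mem_map.1 hx
  obtain ⟨r, hr, -, rfl⟩ := mem_rootRemovals.1 hu
  obtain ⟨hrooted, hweight⟩ := hP hs
  refine Finsupp.single_mem_supported K _ ⟨hrooted.removeRoot hr, ?_⟩
  rwa [← weight_removeRoot hr, Nat.add_lt_add_iff_right] at hweight

open scoped Classical in
theorem rootDeriv_apply (p : ℕ × D) (P : Multiset (Vertex D) →₀ K) (u : Multiset (Vertex D)) :
    rootDeriv K p P u = P.sum fun s a => a * (rootRemovals p s).count u := by
  have sum_single (m : Multiset (Multiset (Vertex D))) :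
      (m.map (Finsupp.single · (1 : K))).sum u = m.count u := by
    induction m using Multiset.induction_on with
    | empty => simp
    | cons s m ih =>
      simp [ih, Multiset.count_cons, Finsupp.single_apply, eq_comm, add_comm]
  rw [rootDeriv, Finsupp.linearCombination_apply, Finsupp.sum_apply]
  simp only [Finsupp.smul_apply, smul_eq_mul, sum_single]

theorem exists_rootDeriv_ne_zero [CharZero K] {P : Multiset (Vertex D) →₀ K}
    (hP : ∀ s ∈ P.support, IsRootedForest s) {s₀ : Multiset (Vertex D)} (hs₀ : s₀ ∈ P.support)
    (hne : s₀ ≠ 0) : ∃ p, rootDeriv K p P ≠ 0 := by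
  classical
  obtain ⟨r₀, hr₀⟩ := Multiset.exists_mem_of_ne_zero hne
  obtain ⟨r, ⟨s, hs, hr⟩, hmin⟩ := exists_minimalFor_of_wellFoundedLT
    (fun r => ∃ s ∈ P.support, r ∈ s) (fun r => (ofRoot r).size) ⟨r₀, s₀, hs₀, hr₀⟩
  have size_le : ∀ s' ∈ P.support, ∀ q ∈ s', (ofRoot r).size ≤ (ofRoot q).size :=
    fun s' hs' q hq => (le_total _ _).elim id (hmin ⟨s', hs', hq⟩)
  refine ⟨(Multiset.card r.2, r.1), fun hzero => ?_⟩
  have coeff_eq_zero := DFunLike.congr_fun hzero (removeRoot s r)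
  have count_of_ne : ∀ s' ∈ P.support, s' ≠ s → P s' *
      ((rootRemovals (Multiset.card r.2, r.1) s').count (removeRoot s r) : K) = 0 := by
    intro s' hs' hss'
    rw [Multiset.count_eq_zero.2, Nat.cast_zero, mul_zero]
    intro hmem
    obtain ⟨r', hr', htype, heq⟩ := mem_rootRemovals.1 hmem
    exact hss' ((hP s hs).eq_of_removeRoot_eq (hP s' hs') hr hr' (size_le s' hs') htype heq).symm
  rw [rootDeriv_apply, Finsupp.sum, Finset.sum_eq_single_of_mem s hs count_of_ne,
    Finsupp.zero_apply, mul_eq_zero, Nat.cast_eq_zero, Multiset.count_eq_zero] at coeff_eq_zero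
  exact coeff_eq_zero.elim (Finsupp.mem_support_iff.1 hs)
    fun h => h (mem_rootRemovals.2 ⟨r, hr, rfl, rfl⟩)

theorem eq_zero_of_forestToBiwords_eq_zero [CharZero K] {N : ℕ} {P : Multiset (Vertex D) →₀ K}
    (hP : P ∈ Finsupp.supported K K {s | IsRootedForest s ∧ weight s < N})
    (h : forestToBiwords K D P = 0) : P = 0 := by
  induction N generalizing P with
  | zero =>
    exact Finsupp.support_eq_empty.1 (Finset.eq_empty_of_forall_notMem fun s hs =>
      Nat.not_lt_zero _ (hP hs).2)
  | succ N ih =>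
    have rootDeriv_eq_zero (p : ℕ × D) : rootDeriv K p P = 0 :=
      ih (rootDeriv_mem_supported p hP) (by rw [forestToBiwords_rootDeriv, h, map_zero])
    have support_le : P.support ⊆ {0} := fun s hs => by
      by_contra hne
      obtain ⟨p, hp⟩ := exists_rootDeriv_ne_zero (fun s hs => (hP hs).1) hs
        (mt Finset.mem_singleton.2 hne)
      exact hp (rootDeriv_eq_zero p)
    obtain ⟨a, rfl⟩ := Finsupp.support_subset_singleton'.1 support_le
    rw [forestToBiwords_single, forestBiword, Multiset.map_zero, shuffleProd_zero,
      Finsupp.smul_single, smul_eq_mul, mul_one, Finsupp.single_eq_zero] at h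
    rw [h, Finsupp.single_zero]

end PartTree

section ForestAlgebra

open PartTree

variable (K : Type v) [Field K] (D : Type u)

theorem Prelie.le_forestAlgebra : Prelie K D ≤ forestAlgebra K D :=
  le_sInf fun _ h => h.1

theorem forestAlgebra_le_supported :
    forestAlgebra K D ≤ Finsupp.supported K K {t | IsRootedForest t.roots} := by
  refine sInf_le ⟨Submodule.span_le.2 ?_, fun x hx y hy => ?_⟩
  · rintro _ ⟨t, ht, rfl⟩
    exact Finsupp.single_mem_supported K _ ht.isRootedForest_roots
  · rw [Finsupp.supported_eq_span_single] at hx hy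
    refine LinearMap.BilinMap.apply_apply_mem_of_mem_span _ _ _ (ComPrelie.shuffle K D) ?_ x y hx hy
    rintro _ ⟨t, ht, rfl⟩ _ ⟨t', ht', rfl⟩
    rw [ComPrelie.shuffle_single_single]
    refine Finsupp.single_mem_supported K _ ?_
    rw [Set.mem_ofPred_eq, roots_merge]
    exact ht.add ht'

theorem injOn_toBiwords_forestAlgebra [CharZero K] :
    Set.InjOn (ComPrelie.toBiwords K D) (forestAlgebra K D) := by
  classical
  intro x hx y hy hxy
  set P := (x - y).mapDomain roots with hP
  have hmem := forestAlgebra_le_supported K D (Submodule.sub_mem _ hx hy)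
  have P_supported : P ∈ Finsupp.supported K K
      {s | IsRootedForest s ∧ weight s < P.support.sup weight + 1} := by
    refine fun s hs => ⟨?_, Nat.lt_succ_of_le (Finset.le_sup (f := weight) hs)⟩
    obtain ⟨t, ht, rfl⟩ := Finset.mem_image.1 (Finsupp.mapDomain_support hs)
    exact hmem ht
  have P_eq_zero : P = 0 := eq_zero_of_forestToBiwords_eq_zero P_supported <| by
    rw [hP, forestToBiwords_mapDomain_roots, map_sub, hxy, sub_self]
  exact sub_eq_zero.1
    (Finsupp.mapDomain_injective roots_injective (P_eq_zero.trans Finsupp.mapDomain_zero.symm))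

end ForestAlgebra

theorem theorem31 (K : Type*) [Field K] [CharZero K] (D : Type*) :
    ∃ (Φ_CPL : ComPrelie K D →ₗ[K] Biwords K D) (Φ_PL : Prelie K D →ₗ[K] Biwords K D),
      (IsPhiCPL Φ_CPL ∧ ∀ Ψ : ComPrelie K D →ₗ[K] Biwords K D, IsPhiCPL Ψ → Ψ = Φ_CPL) ∧
      (IsPhiPL Φ_PL ∧ ∀ ψ : Prelie K D →ₗ[K] Biwords K D, IsPhiPL ψ → ψ = Φ_PL) ∧
      Φ_PL = Φ_CPL.domRestrict (Prelie K D) ∧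
      Function.Injective Φ_PL ∧
      Set.InjOn Φ_CPL (forestAlgebra K D) := by
  have hΦ := ComPrelie.isPhiCPL_toBiwords K D
  have hinj := injOn_toBiwords_forestAlgebra K D
  refine ⟨ComPrelie.toBiwords K D, (ComPrelie.toBiwords K D).domRestrict (Prelie K D),
    ⟨hΦ, fun Ψ hΨ => hΨ.ext hΦ⟩, ⟨hΦ.domRestrict, fun ψ hψ => hψ.ext hΦ.domRestrict⟩, rfl,
    fun x y hxy => Subtype.ext ?_, hinj⟩
  exact hinj (Prelie.le_forestAlgebra K D x.2) (Prelie.le_forestAlgebra K D y.2) hxy
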